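/- **Direct part of the quantum channel coding theorem.** Let $\mathcal H$ be a finite-dimensional complex Hilbert space, $\mathcal X$ a nonempty finite set, and $x\mapsto\rho_x$ a map from $\mathcal X$ to the density operators on $\mathcal H$ (positive semidefinite operators of trace one). For a probability distribution $p$ on $\mathcal X$ put $\sigma_p=\sum_{x}p(x)\rho_x$ and $$I(p)=H(\sigma_p)-\sum_{x\in\mathcal X}p(x)H(\rho_x),\qquad H(\rho)=-\operatorname{Tr}[\rho\log\rho].$$ Let $D(\rho\|\sigma)=\operatorname{Tr}[\rho(\log\rho-\log\sigma)]$ if $\operatorname{supp}\rho\subseteq\operatorname{supp}\sigma$ and $D(\rho\|\sigma)=+\infty$ otherwise (natural logarithms, $0\log 0=0$, $0\cdot\infty=0$). A code of block length $n$ consists of $M_n\ge 1$ distinct codewords $u^1,\dots,u^{M_n}\in\mathcal X^n$ and positive semidefinite operators $X_1,\dots,X_{M_n}$ on $\mathcal H^{\otimes n}$ with $\sum_{k}X_k\le I$. Its average error probability is $$\mathrm{Pe}=\frac1{M_n}\sum_{k=1}^{M_n}\bigl(1-\operatorname{Tr}[\rho_{u^k}X_k]\bigr),\qquad \rho_{x_1\cdots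 x_n}=\rho_{x_1}\otimes\cdots\otimes\rho_{x_n}.$$ A real number $R$ is called achievable if there is a sequence of codes, one for each block length $n$, with $$\lim_{n\to\infty}\mathrm{Pe}=0\quad\text{and}\quad\liminf_{n\to\infty}\frac1n\log M_n\ge R,$$ and the capacity $C$ is the supremum of the achievable $R$. Then: 1. for every probability distribution $p$ on $\mathcal X$, $I(p)=\sum_{x}p(x)D(\rho_x\|\sigma_p)$; 2. for every probability distribution $p$ on $\mathcal X$, every real $a<I(p)$ is achievable; 3. $I$ attains its maximum over the probability distributions on $\mathcal X$, and $C\ge\max_p I(p)$. -/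

import Mathlib

open Filter Topology
open scoped Matrix ComplexOrder

noncomputable section

namespace QuantumChannel

/-- Density operators on `ℂ^d`: positive semidefinite (in particular Hermitian) of trace one. -/
def IsDensityOperator {d : Type*} [Fintype d] (A : Matrix d d ℂ) : Prop :=
  A.PosSemidef ∧ A.trace = 1

/-- The logarithm of a Hermitian matrix by functional calculus, with `log 0 = 0` on its kernel. -/
def matrixLog {d : Type*} [Fintype d] [DecidableEq d] (A : Matrix d d ℂ) : Matrix d d ℂ :=
  cfc Real.log A

/-- The von Neumann entropy `H(ρ) = -Tr[ρ log ρ]`, natural logarithm, `0 log 0 = 0`. -/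
def entropy {d : Type*} [Fintype d] [DecidableEq d] (ρ : Matrix d d ℂ) : ℝ :=
  -(ρ * matrixLog ρ).trace.re

open Classical in
/-- The quantum relative entropy `D(ρ‖σ) = Tr[ρ (log ρ - log σ)]` if the support of `ρ` is
contained in the support of `σ` (that is, `ker σ ⊆ ker ρ`), and `D(ρ‖σ) = +∞` otherwise. -/
def relativeEntropy {d : Type*} [Fintype d] [DecidableEq d] (ρ σ : Matrix d d ℂ) : EReal :=
  if ∀ v : d → ℂ, σ *ᵥ v = 0 → ρ *ᵥ v = 0 then
    (((ρ * (matrixLog ρ - matrixLog σ)).trace.re : ℝ) : EReal)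
  else ⊤

/-- The mixture state `σ_p = ∑ x, p(x) ρ_x`. -/
def mixture {X d : Type*} [Fintype X] (ρ : X → Matrix d d ℂ) (p : X → ℝ) : Matrix d d ℂ :=
  ∑ x, p x • ρ x

/-- The quantum mutual information `I(p) = H(σ_p) - ∑ x, p(x) H(ρ_x)`. -/
def mutualInformation {X d : Type*} [Fintype X] [Fintype d] [DecidableEq d]
    (ρ : X → Matrix d d ℂ) (p : X → ℝ) : ℝ :=
  entropy (mixture ρ p) - ∑ x, p x * entropy (ρ x)

/-- The output state `ρ_{x_1} ⊗ ⋯ ⊗ ρ_{x_n}` of the `n`-th extension of the channel on the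
word `u = x_1 … x_n`, as a matrix in the product basis of `(ℂ^d)^{⊗ n}`, which is indexed by
`Fin n → d`. -/
def outputState {X d : Type*} (ρ : X → Matrix d d ℂ) {n : ℕ} (u : Fin n → X) :
    Matrix (Fin n → d) (Fin n → d) ℂ :=
  Matrix.of fun i j => ∏ t, ρ (u t) (i t) (j t)

/-- A code of block length `n`: a nonempty codebook of `size` distinct codewords in `X^n`, and a
decoder, a family of nonnegative operators on `(ℂ^d)^{⊗ n}` with sum at most the identity. -/
structure Code (X d : Type*) [Fintype d] [DecidableEq d] (n : ℕ) where
  size : ℕ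
  size_pos : 0 < size
  codeword : Fin size → (Fin n → X)
  codeword_injective : Function.Injective codeword
  decoder : Fin size → Matrix (Fin n → d) (Fin n → d) ℂ
  decoder_nonneg : ∀ k, (decoder k).PosSemidef
  decoder_sum_le : (1 - ∑ k, decoder k).PosSemidef

/-- The average error probability `Pe = (1/M) ∑ k, (1 - Tr[ρ_{u^k} X_k])`. -/
def Code.errorProb {X d : Type*} [Fintype d] [DecidableEq d] {n : ℕ}
    (c : Code X d n) (ρ : X → Matrix d d ℂ) : ℝ :=
  1 / (c.size : ℝ) * ∑ k, (1 - (outputState ρ (c.codeword k) * c.decoder k).trace.re)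

/-- `R` is achievable: there is a sequence of codes, one for each block length `n`, with
`Pe → 0` and `liminf (1/n) log M_n ≥ R`. The inferior limit is taken in the extended reals. The
term `n = 0` is irrelevant: there is always a code of block length `0`. -/
def IsAchievable {X d : Type*} [Fintype d] [DecidableEq d]
    (ρ : X → Matrix d d ℂ) (R : ℝ) : Prop :=
  ∃ c : (n : ℕ) → Code X d n,
    Tendsto (fun n => (c n).errorProb ρ) atTop (𝓝 0) ∧
    (R : EReal) ≤ liminf (fun n : ℕ => ((1 / (n : ℝ) * Real.log (c n).size : ℝ) : EReal)) atTop

/-- The capacity: the supremum, in the extended reals, of the achievable rates. -/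
def capacity {X d : Type*} [Fintype d] [DecidableEq d] (ρ : X → Matrix d d ℂ) : EReal :=
  ⨆ R ∈ {R : ℝ | IsAchievable ρ R}, (R : EReal)

end QuantumChannel

end

/-!
The direct part of the quantum channel coding theorem rests on random coding with square-root
measurements.

Fix `p` and `b < I(p)`. Typicality provides tests `0 ≤ T u ≤ 1`, one for each word `u`, which accept
the output state of `u` with probability tending to one on average over `u`, but accept the average
output state, the tensor power of the mixture, with probability at most `exp (-n b)`
(`exists_tests`). Such a test is `Q P_u Q`, with `Q` a spectral projection of the average state onto
its eigenvalues up to about `exp (-n H)`, where `H` is the entropy of the mixture, and `P_u` a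
spectral projection of the output state of `u` onto its eigenvalues from about `exp (-n K)` on, of
rank at most about `exp (n K)`, where `K` is the average entropy of the `ρ x`. The defect of the
compression is at most `3 (1 - Q) + 2 (1 - P_u)` (`one_sub_conjugate_le`), and the averages of both
summands are probabilities of deviations of sums of independent variables, bounded by Chebyshev's
inequality (`weakLaw`).

For words `u 1, …, u M` the decoder is `W T(u k) W` with `W = (∑ j, T (u j) + ε) ^ (-1/2)`. The
Hayashi–Nagaoka inequality (`exists_inv_sqrt_hayashiNagaoka`) bounds the error of the word `u k` by
`2 (1 - Tr ρ_{u k} T (u k)) + 4 ∑ j ≠ k, Tr ρ_{u k} T (u j) + 4 ε`. For independent random words of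
law `p ^ n`, the cross terms average to at most `4 M exp (-n b)`, which tends to zero if `M` is of
order `exp (n a)` with `a < b` (`exists_randomCode`). Discarding the words with error at least `1/2`
loses at most half of the words and leaves distinct ones (`exists_code_of_words`).

The formula for `I(p)` by relative entropies is linearity of the trace, once the support of `ρ x` is
known to lie in that of the mixture. The maximum exists because the entropy is continuous on density
operators, by continuity of the functional calculus of the continuous function `x ↦ -x log x`.
-/

noncomputable section

namespace QuantumChannel

/-! ### Two operator inequalities -/

section HayashiNagaoka

variable {A : Type*} [CStarAlgebra A] [PartialOrder A] [StarOrderedRing A]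

/-- `S ≤ 1` gives `S² ≤ S ≤ L`, and the square root is operator monotone. -/
lemma self_le_sqrt_of_le {S L : A} (hS : 0 ≤ S) (hS1 : S ≤ 1) (hSL : S ≤ L) :
    S ≤ CFC.sqrt L := by
  have hsq : S * S ≤ S := by
    have hr : IsSelfAdjoint (CFC.sqrt S) := (CFC.sqrt_nonneg S).isSelfAdjoint
    have h := hr.conjugate_le_conjugate hS1
    have hrr : CFC.sqrt S * CFC.sqrt S = S := CFC.sqrt_mul_sqrt_self S hS
    have hc : CFC.sqrt S * S = S * CFC.sqrt S := by
      nth_rw 2 [← hrr]; nth_rw 4 [← hrr]; rw [mul_assoc]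
    rwa [hc, mul_assoc, mul_one, hrr] at h
  calc S = CFC.sqrt (S * S) := (CFC.sqrt_mul_self S hS).symm
    _ ≤ CFC.sqrt L := CFC.sqrt_le_sqrt _ _ (hsq.trans hSL)

/-- The **Hayashi–Nagaoka inequality**, with `W = L ^ (-1/2)`. For `T = L - S` one has
`1 - W S W = W T W ≤ 2 T + 2 (W - 1) T (W - 1)`. In the last summand `T ≤ L` gives
`(W - 1) L (W - 1) = 1 - 2 √L + L`, and `S ≤ √L` closes the estimate. -/
lemma exists_inv_sqrt_hayashiNagaoka {L : A} (hL : 0 ≤ L) (hLu : IsUnit L) :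
    ∃ W : A, IsSelfAdjoint W ∧ W * L * W = 1 ∧ ∀ S : A, 0 ≤ S → S ≤ 1 → S ≤ L →
      1 - W * S * W ≤ 2 • (1 - S) + 4 • (L - S) := by
  have hRR : CFC.sqrt L * CFC.sqrt L = L := CFC.sqrt_mul_sqrt_self L hL
  have hRu : IsUnit (CFC.sqrt L) := (CFC.isUnit_sqrt_iff L hL).2 hLu
  have hRs : IsSelfAdjoint (CFC.sqrt L) := (CFC.sqrt_nonneg L).isSelfAdjoint
  have hSR : ∀ S : A, 0 ≤ S → S ≤ 1 → S ≤ L → S ≤ CFC.sqrt L :=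
    fun S h0 h1 h2 => self_le_sqrt_of_le h0 h1 h2
  generalize CFC.sqrt L = R at *
  obtain ⟨u, rfl⟩ := hRu
  have hW : IsSelfAdjoint (↑u⁻¹ : A) := by
    rw [IsSelfAdjoint, ← Units.coe_star_inv]
    congr 2
    exact Units.ext hRs
  have hWLW : (↑u⁻¹ : A) * L * ↑u⁻¹ = 1 := by rw [← hRR]; simp
  refine ⟨↑u⁻¹, hW, hWLW, fun S h0 h1 h2 => ?_⟩
  have hT : 0 ≤ L - S := sub_nonneg.2 h2
  have hW1 : IsSelfAdjoint ((↑u⁻¹ : A) - 1) := hW.sub (.one A)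
  have hW2 : IsSelfAdjoint ((↑u⁻¹ : A) - 2) := hW.sub (by simp [IsSelfAdjoint])
  have e1 : (((↑u⁻¹ : A) - 1) * L * (↑u⁻¹ - 1)) = 1 - 2 • (u : A) + L := by
    rw [← hRR]
    have a1 : (↑u⁻¹ : A) * u = 1 := by simp
    have a2 : (u : A) * ↑u⁻¹ = 1 := by simp
    calc _ = ((↑u⁻¹ : A) * u - u) * (u * (↑u⁻¹ : A) - u) := by noncomm_ring
      _ = _ := by rw [a1, a2]; noncomm_ring
  have i1 : 0 ≤ ((↑u⁻¹ : A) - 2) * (L - S) * (↑u⁻¹ - 2) := hW2.conjugate_nonneg hT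
  have i2 : ((↑u⁻¹ : A) - 1) * (L - S) * (↑u⁻¹ - 1) ≤ 1 - 2 • (u : A) + L :=
    e1 ▸ hW1.conjugate_le_conjugate (sub_le_self L h0)
  have i3 := hSR S h0 h1 h2
  have e2 : 1 - (↑u⁻¹ : A) * S * ↑u⁻¹ = ↑u⁻¹ * (L - S) * ↑u⁻¹ := by
    rw [mul_sub, sub_mul, hWLW]
  rw [e2, ← sub_nonneg]
  have e3 : 2 • (1 - S) + 4 • (L - S) - (↑u⁻¹ : A) * (L - S) * ↑u⁻¹ =
      ((↑u⁻¹ : A) - 2) * (L - S) * (↑u⁻¹ - 2)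
      + 2 • ((1 - 2 • (u : A) + L) - ((↑u⁻¹ : A) - 1) * (L - S) * (↑u⁻¹ - 1))
      + 4 • ((u : A) - S) := by noncomm_ring
  rw [e3]
  have := nsmul_nonneg (sub_nonneg.2 i2) 2
  have := nsmul_nonneg (sub_nonneg.2 i3) 4
  positivity

/-- Compressing a test `P` by a projection `Q` costs at most a multiple of the two separate
defects, and this holds as an operator inequality, with no square root of a defect. -/
lemma one_sub_conjugate_le {P Q : A} (hP0 : 0 ≤ P) (hP1 : P ≤ 1) (hQ : IsSelfAdjoint Q)
    (hQQ : Q * Q = Q) :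
    1 - Q * P * Q ≤ 3 • (1 - Q) + 2 • (1 - P) := by
  have hr : 0 ≤ 1 - P := sub_nonneg.2 hP1
  have h1 : 0 ≤ (1 + (1 - Q)) * (1 - P) * (1 + (1 - Q)) :=
    ((IsSelfAdjoint.one A).add ((IsSelfAdjoint.one A).sub hQ)).conjugate_nonneg hr
  have h2 : 0 ≤ (1 - Q) * P * (1 - Q) := ((IsSelfAdjoint.one A).sub hQ).conjugate_nonneg hP0
  rw [← sub_nonneg]
  have e : 3 • (1 - Q) + 2 • (1 - P) - (1 - Q * P * Q) =
      (1 + (1 - Q)) * (1 - P) * (1 + (1 - Q)) + 2 • ((1 - Q) * P * (1 - Q)) := by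
    have e0 : (1 - Q) * (1 - Q) = 1 - Q := by
      rw [mul_sub, mul_one, sub_mul, one_mul, hQQ, sub_self, sub_zero]
    have e1 : 3 • (1 - Q) + 2 • (1 - P) - (1 - Q * P * Q) =
        2 • (1 - P) + 2 • ((1 - Q) * (1 - Q)) - (Q * Q - Q * P * Q) := by
      rw [hQQ, e0]; noncomm_ring
    rw [e1]
    noncomm_ring
  rw [e]
  have := nsmul_nonneg h2 2
  positivity

end HayashiNagaoka

/-! ### Independent samples from a finite set -/

section IID

variable {Y : Type*} [Fintype Y] {n : ℕ} {q : Y → ℝ}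

lemma sum_prod_eq_one (hq : ∑ y, q y = 1) : ∑ u : Fin n → Y, ∏ k, q (u k) = 1 := by
  classical
  rw [← Fintype.piFinset_univ, ← Finset.prod_univ_sum]
  simp [hq]

/-- The one-coordinate marginal of the product law is `q`. -/
lemma sum_prod_mul_apply (hq : ∑ y, q y = 1) (i : Fin n) (a : Y → ℝ) :
    ∑ u : Fin n → Y, (∏ k, q (u k)) * a (u i) = ∑ y, q y * a y := by
  classical
  have h : ∀ u : Fin n → Y, (∏ k, q (u k)) * a (u i) =
      ∏ k, (q (u k) * if k = i then a (u k) else 1) := fun u => by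
    rw [Finset.prod_mul_distrib]; simp
  simp_rw [h]
  rw [← Fintype.piFinset_univ,
    ← Finset.prod_univ_sum (fun _ => Finset.univ) (fun k y => q y * if k = i then a y else 1)]
  rw [Finset.prod_eq_single i (fun k _ hk => by simp [hk, hq]) (by simp)]
  simp

/-- The marginal of the product law in two different coordinates is `q ⊗ q`. -/
lemma sum_prod_mul_apply₂ (hq : ∑ y, q y = 1) {i j : Fin n} (hij : i ≠ j) (f : Y → Y → ℝ) :
    ∑ u : Fin n → Y, (∏ k, q (u k)) * f (u i) (u j) = ∑ y, ∑ z, q y * q z * f y z := by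
  classical
  have h : ∀ u : Fin n → Y, (∏ k, q (u k)) * f (u i) (u j) =
      ∑ y, ∏ k, (q (u k) * (if k = i then if u k = y then 1 else 0 else 1) *
        if k = j then f y (u k) else 1) := fun u => by
    simp_rw [Finset.prod_mul_distrib]; simp
  simp_rw [h]
  rw [Finset.sum_comm]
  refine Finset.sum_congr rfl fun y _ => ?_
  rw [← Fintype.piFinset_univ, ← Finset.prod_univ_sum (fun _ => Finset.univ)
    (fun k z => (q z * if k = i then if z = y then 1 else 0 else 1) * if k = j then f y z else 1)]
  rw [← Finset.mul_prod_erase _ _ (Finset.mem_univ i),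
    ← Finset.mul_prod_erase _ _ (Finset.mem_erase.2 ⟨hij.symm, Finset.mem_univ j⟩),
    Finset.prod_eq_one]
  · simp [hij, hij.symm, Finset.mul_sum, mul_assoc]
  · intro k hk
    simp only [Finset.mem_erase] at hk
    simp [hk.1, hk.2.1, hq]

/-- The variance of a sum of `n` independent centred variables is `n` times the variance of one
of them. -/
lemma sum_prod_mul_sq_sum (hq : ∑ y, q y = 1) {g : Y → ℝ} (hg : ∑ y, q y * g y = 0) :
    ∑ u : Fin n → Y, (∏ k, q (u k)) * (∑ t, g (u t)) ^ 2 = n * ∑ y, q y * g y ^ 2 := by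
  classical
  simp_rw [sq, Finset.sum_mul_sum, Finset.mul_sum]
  rw [Finset.sum_comm]
  have : ∀ i : Fin n, ∑ u : Fin n → Y, ∑ j, (∏ k, q (u k)) * (g (u i) * g (u j)) =
      ∑ y, q y * (g y * g y) := by
    intro i
    rw [Finset.sum_comm, Finset.sum_eq_single i]
    · exact sum_prod_mul_apply hq i (fun y => g y * g y)
    · intro j _ hj
      rw [sum_prod_mul_apply₂ hq hj.symm (fun y z => g y * g z)]
      have : ∀ y z, q y * q z * (g y * g z) = (q y * g y) * (q z * g z) := fun y z => by ring
      simp_rw [this, ← Finset.mul_sum, hg]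
      simp
    · simp
  rw [Finset.sum_congr rfl fun i _ => this i]
  simp [Finset.mul_sum]

/-- Chebyshev's inequality for `n` independent samples of law `q` on a finite set. -/
lemma weakLaw (hq0 : ∀ y, 0 ≤ q y) (hq : ∑ y, q y = 1) (f : Y → ℝ) {δ : ℝ} (hδ : 0 < δ)
    (hn : 0 < n) (s : Finset (Fin n → Y))
    (hs : ∀ u ∈ s, n * δ ≤ |∑ t, f (u t) - n * ∑ y, q y * f y|) :
    ∑ u ∈ s, ∏ k, q (u k) ≤
      (∑ y, q y * (f y - ∑ z, q z * f z) ^ 2) / δ ^ 2 * (n : ℝ)⁻¹ := by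
  set μ := ∑ y, q y * f y
  have hg : ∑ y, q y * (f y - μ) = 0 := by
    simp_rw [mul_sub, Finset.sum_sub_distrib, ← Finset.sum_mul, hq]; simp [μ]
  have hn' : (0 : ℝ) < n := by exact_mod_cast hn
  have key := sum_prod_mul_sq_sum (n := n) hq hg
  have h1 : (n * δ) ^ 2 * ∑ u ∈ s, ∏ k, q (u k) ≤ n * ∑ y, q y * (f y - μ) ^ 2 := by
    rw [← key, Finset.mul_sum]
    refine (Finset.sum_le_sum fun u hu => ?_).trans
      (Finset.sum_le_sum_of_subset_of_nonneg s.subset_univ fun u _ _ =>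
        mul_nonneg (Finset.prod_nonneg fun k _ => hq0 _) (sq_nonneg _))
    rw [mul_comm]
    refine mul_le_mul_of_nonneg_left ?_ (Finset.prod_nonneg fun k _ => hq0 _)
    have := hs u hu
    rw [← sq_abs (∑ t, _)]
    have e : ∑ t, (f (u t) - μ) = ∑ t, f (u t) - n * μ := by
      rw [Finset.sum_sub_distrib]; simp
    rw [e]
    gcongr
  rw [div_mul_eq_mul_div, le_div_iff₀ (by positivity)]
  rw [mul_pow] at h1
  have h2 : (n : ℝ) ^ 2 * (δ ^ 2 * ∑ u ∈ s, ∏ k, q (u k)) ≤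
      (n : ℝ) ^ 2 * ((∑ y, q y * (f y - μ) ^ 2) * (n : ℝ)⁻¹) := by
    calc _ = (n : ℝ) ^ 2 * δ ^ 2 * ∑ u ∈ s, ∏ k, q (u k) := by ring
      _ ≤ _ := h1
      _ = _ := by field_simp
  have := le_of_mul_le_mul_left h2 (by positivity)
  linarith

end IID

/-! ### The square-root measurement and random coding -/

section Decoder

open scoped MatrixOrder Matrix.Norms.L2Operator

variable {m : Type*} [Fintype m]

lemma trace_mul_re_nonneg {A B : Matrix m m ℂ} (hA : A.PosSemidef) (hB : B.PosSemidef) :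
    0 ≤ (A * B).trace.re := by
  classical
  obtain ⟨C, rfl⟩ := CStarAlgebra.nonneg_iff_eq_star_mul_self.1 hA.nonneg
  rw [mul_assoc, Matrix.trace_mul_comm]
  exact (Complex.le_def.1 (hB.mul_mul_conjTranspose_same C).trace_nonneg).1

lemma trace_mul_re_mono {A B C : Matrix m m ℂ} (hA : A.PosSemidef) (hBC : B ≤ C) :
    (A * B).trace.re ≤ (A * C).trace.re := by
  have := trace_mul_re_nonneg hA (Matrix.le_iff.1 hBC)
  rw [mul_sub, Matrix.trace_sub, Complex.sub_re] at this
  linarith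

variable [DecidableEq m]

/-- The square-root measurement associated with operators `0 ≤ S i ≤ 1`. The summand `ε` makes the
normalising operator `∑ i, S i + ε` invertible. -/
lemma exists_squareRootMeasurement {ι : Type*} [Fintype ι] [DecidableEq ι]
    (S : ι → Matrix m m ℂ) (hS0 : ∀ i, 0 ≤ S i) (hS1 : ∀ i, S i ≤ 1) {ε : ℝ} (hε : 0 < ε) :
    ∃ D : ι → Matrix m m ℂ, (∀ i, (D i).PosSemidef) ∧ (1 - ∑ i, D i).PosSemidef ∧
      ∀ i, ∀ τ : Matrix m m ℂ, IsDensityOperator τ →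
        1 - (τ * D i).trace.re ≤ 2 * (1 - (τ * S i).trace.re) +
          4 * ∑ j ∈ Finset.univ.erase i, (τ * S j).trace.re + 4 * ε := by
  set E : Matrix m m ℂ := (ε : ℂ) • 1
  have hE : E.PosDef := Matrix.PosDef.one.smul (by exact_mod_cast hε)
  have hsum : 0 ≤ ∑ i, S i := Finset.sum_nonneg fun i _ => hS0 i
  have hL : (∑ i, S i + E).PosDef :=
    Matrix.PosDef.posSemidef_add (Matrix.nonneg_iff_posSemidef.1 hsum) hE
  obtain ⟨W, hW, hWL, hHN⟩ := exists_inv_sqrt_hayashiNagaoka hL.posSemidef.nonneg hL.isUnit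
  refine ⟨fun i => W * S i * W,
    fun i => Matrix.nonneg_iff_posSemidef.1 (hW.conjugate_nonneg (hS0 i)), ?_, ?_⟩
  · have h : 1 - ∑ i, W * S i * W = W * E * W := by
      rw [← hWL, ← Finset.sum_mul, ← Finset.mul_sum]
      noncomm_ring
    rw [h]
    exact Matrix.nonneg_iff_posSemidef.1 (hW.conjugate_nonneg hE.posSemidef.nonneg)
  · intro i τ hτ
    have hle : S i ≤ ∑ i, S i + E :=
      (Finset.single_le_sum (fun j _ => hS0 j) (Finset.mem_univ i)).trans
        (le_add_of_nonneg_right hE.posSemidef.nonneg)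
    have h := trace_mul_re_mono hτ.1 (hHN (S i) (hS0 i) (hS1 i) hle)
    have hd : ∑ j, S j + E - S i = ∑ j ∈ Finset.univ.erase i, S j + E := by
      rw [← Finset.add_sum_erase _ _ (Finset.mem_univ i)]; abel
    rw [hd] at h
    simp only [mul_add, mul_sub, mul_one, mul_smul_comm, Matrix.trace_sub, Matrix.trace_add,
      Matrix.trace_smul, hτ.2, Finset.mul_sum, Matrix.trace_sum, E, smul_eq_mul,
      Complex.sub_re, Complex.add_re, Complex.re_sum, Complex.re_nsmul] at h
    simp only [nsmul_eq_mul, Complex.one_re, Complex.ofReal_re] at h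
    push_cast at h
    linarith

/-- Random coding. The codewords `u k` are independent of law `q`, the decoder is the square-root
measurement of the tests `T (u k)`. Averaged over the codebook, the first summand of the bound in
`exists_squareRootMeasurement` is controlled by `α`, and each of the cross terms, because `u k` and
`u j` are independent, by `β`. Some codebook is at least as good as the average one; its words need
not be distinct. -/
lemma exists_randomCode {Y : Type*} [Fintype Y] {q : Y → ℝ} (hq0 : ∀ y, 0 ≤ q y)
    (hq : ∑ y, q y = 1) (τ : Y → Matrix m m ℂ) (hτ : ∀ y, IsDensityOperator (τ y))
    (T : Y → Matrix m m ℂ) (hT0 : ∀ y, 0 ≤ T y) (hT1 : ∀ y, T y ≤ 1) {α β ε : ℝ}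
    (hα : ∑ y, q y * (1 - (τ y * T y).trace.re) ≤ α)
    (hβ : ∀ y, ((∑ z, q z • τ z) * T y).trace.re ≤ β) (hε : 0 < ε) (M : ℕ) :
    ∃ (u : Fin M → Y) (D : Fin M → Matrix m m ℂ), (∀ k, (D k).PosSemidef) ∧
      (1 - ∑ k, D k).PosSemidef ∧
      ∑ k, (1 - (τ (u k) * D k).trace.re) ≤ M * (2 * α + 4 * (M * β) + 4 * ε) := by
  choose D hD0 hD1 hD using fun u : Fin M → Y => exists_squareRootMeasurement
    (fun k => T (u k)) (fun k => hT0 (u k)) (fun k => hT1 (u k)) hε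
  have hβ' : ∑ y, ∑ z, q y * q z * (τ y * T z).trace.re ≤ β := by
    rw [Finset.sum_comm]
    calc _ = ∑ z, q z * ((∑ y, q y • τ y) * T z).trace.re := by
          refine Finset.sum_congr rfl fun z _ => ?_
          rw [Finset.sum_mul, Matrix.trace_sum, Complex.re_sum, Finset.mul_sum]
          refine Finset.sum_congr rfl fun y _ => ?_
          rw [smul_mul_assoc, Matrix.trace_smul, Complex.smul_re, smul_eq_mul]
          ring
      _ ≤ ∑ z, q z * β := Finset.sum_le_sum fun z _ => mul_le_mul_of_nonneg_left (hβ z) (hq0 z)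
      _ = β := by rw [← Finset.sum_mul, hq, one_mul]
  have hβ0 : 0 ≤ β := le_trans (Finset.sum_nonneg fun y _ => Finset.sum_nonneg fun z _ =>
    mul_nonneg (mul_nonneg (hq0 y) (hq0 z))
      (trace_mul_re_nonneg (hτ y).1 (Matrix.nonneg_iff_posSemidef.1 (hT0 z)))) hβ'
  -- the bound of `hD`, averaged over the random codebook
  set B : (Fin M → Y) → ℝ := fun u => ∑ k, (2 * (1 - (τ (u k) * T (u k)).trace.re) +
    4 * ∑ j ∈ Finset.univ.erase k, (τ (u k) * T (u j)).trace.re + 4 * ε)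
  have havg : ∑ u : Fin M → Y, (∏ k, q (u k)) * B u ≤ M * (2 * α + 4 * (M * β) + 4 * ε) := by
    simp only [B, Finset.mul_sum]
    rw [Finset.sum_comm]
    have : ∀ k : Fin M, ∑ u : Fin M → Y, (∏ k, q (u k)) *
        (2 * (1 - (τ (u k) * T (u k)).trace.re) +
        ∑ j ∈ Finset.univ.erase k, 4 * (τ (u k) * T (u j)).trace.re + 4 * ε) ≤
        2 * α + 4 * (M * β) + 4 * ε := by
      intro k
      simp only [mul_add, Finset.sum_add_distrib, Finset.mul_sum]
      refine add_le_add (add_le_add ?_ ?_) ?_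
      · rw [sum_prod_mul_apply hq k (fun y => 2 * (1 - (τ y * T y).trace.re))]
        simp_rw [mul_left_comm _ (2 : ℝ), ← Finset.mul_sum]
        linarith
      · rw [Finset.sum_comm]
        calc _ ≤ ∑ j ∈ Finset.univ.erase k, 4 * β := by
              refine Finset.sum_le_sum fun j hj => ?_
              rw [sum_prod_mul_apply₂ hq (Finset.ne_of_mem_erase hj).symm
                (fun y z => 4 * (τ y * T z).trace.re)]
              simp_rw [mul_left_comm _ (4 : ℝ), ← Finset.mul_sum]
              linarith
          _ ≤ ∑ j : Fin M, 4 * β := Finset.sum_le_sum_of_subset_of_nonneg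
              (Finset.erase_subset _ _) fun _ _ _ => by positivity
          _ = 4 * (M * β) := by simp; ring
      · rw [← Finset.sum_mul, sum_prod_eq_one hq, one_mul]
    calc _ ≤ ∑ k : Fin M, (2 * α + 4 * (M * β) + 4 * ε) := Finset.sum_le_sum fun k _ => this k
      _ = _ := by simp only [Finset.sum_const, Finset.card_univ, Fintype.card_fin, nsmul_eq_mul]
  have hex : ∃ u, B u ≤ M * (2 * α + 4 * (M * β) + 4 * ε) := by
    by_contra! h
    refine absurd havg (not_le.2 ?_)
    have hne : ∃ u ∈ (Finset.univ : Finset (Fin M → Y)), 0 < ∏ k, q (u k) :=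
      Finset.exists_lt_of_sum_lt (by rw [sum_prod_eq_one hq]; simp)
    calc _ = ∑ u : Fin M → Y, (∏ k, q (u k)) * (M * (2 * α + 4 * (M * β) + 4 * ε)) := by
          rw [← Finset.sum_mul, sum_prod_eq_one hq, one_mul]
      _ < _ := Finset.sum_lt_sum
        (fun u _ => mul_le_mul_of_nonneg_left (h u).le (Finset.prod_nonneg fun k _ => hq0 _))
        (hne.imp fun u hu => ⟨hu.1, mul_lt_mul_of_pos_left (h u) hu.2⟩)
  obtain ⟨u, hu⟩ := hex
  exact ⟨u, D u, hD0 u, hD1 u,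
    (Finset.sum_le_sum fun k _ => hD u k (τ (u k)) (hτ (u k))).trans hu⟩

end Decoder

/-! ### Expurgation -/

section Expurgation

variable {X d : Type*} [Fintype d] [DecidableEq d] {n : ℕ}

/-- Expurgation. The words with error below `1 / 2` are at least half of all words if the average
error is below `1 / 4`. They are distinct: the decoding operators of two equal words with error
below `1 / 2` would have total probability above `1`. -/
lemma exists_code_of_words (ρ : X → Matrix d d ℂ)
    (hρ : ∀ u : Fin n → X, IsDensityOperator (outputState ρ u)) {M : ℕ} (hM : 0 < M)
    (u : Fin M → Fin n → X) (D : Fin M → Matrix (Fin n → d) (Fin n → d) ℂ)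
    (hD0 : ∀ k, (D k).PosSemidef) (hD1 : (1 - ∑ k, D k).PosSemidef) {e : ℝ} (he : e < 1 / 4)
    (hu : ∑ k, (1 - (outputState ρ (u k) * D k).trace.re) ≤ M * e) :
    ∃ c : Code X d n, (M : ℝ) / 2 ≤ c.size ∧ c.errorProb ρ ≤ 2 * e := by
  classical
  open scoped MatrixOrder in
  have hmono : ∀ (v : Fin n → X) (s : Finset (Fin M)),
      ∑ k ∈ s, (outputState ρ v * D k).trace.re ≤ 1 := by
    intro v s
    have h1 : ∑ k ∈ s, D k ≤ 1 := (Finset.sum_le_sum_of_subset_of_nonneg s.subset_univ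
      fun k _ _ => (hD0 k).nonneg).trans (Matrix.le_iff.2 hD1)
    have h2 := trace_mul_re_mono (hρ v).1 h1
    simpa [Finset.mul_sum, (hρ v).2] using h2
  set err : Fin M → ℝ := fun k => 1 - (outputState ρ (u k) * D k).trace.re
  have herr : ∀ k, 0 ≤ err k := fun k => by
    have := hmono (u k) {k}
    simp only [Finset.sum_singleton] at this
    simp only [err]; linarith
  set s : Finset (Fin M) := Finset.univ.filter fun k => err k < 1 / 2
  -- at most half of the words have error at least `1/2`
  have hcard : (M : ℝ) / 2 < s.card := by
    have h1 : (1 / 2 : ℝ) * (sᶜ.card : ℝ) ≤ M * e := by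
      calc (1 / 2 : ℝ) * (sᶜ.card : ℝ) = ∑ k ∈ sᶜ, (1 / 2 : ℝ) := by simp [mul_comm]
        _ ≤ ∑ k ∈ sᶜ, err k := Finset.sum_le_sum fun k hk => by
            simpa [s] using hk
        _ ≤ ∑ k, err k := Finset.sum_le_sum_of_subset_of_nonneg (Finset.subset_univ _)
            fun k _ _ => herr k
        _ ≤ _ := hu
    have h2 : (s.card : ℝ) + sᶜ.card = M := by
      exact_mod_cast (Finset.card_add_card_compl s).trans (Fintype.card_fin M)
    have hM' : (0 : ℝ) < M := by exact_mod_cast hM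
    nlinarith
  have hM' : (0 : ℝ) < M := by exact_mod_cast hM
  have hs : (0 : ℝ) < s.card := by linarith
  let f := s.equivFin.symm
  have hinj : Function.Injective fun k => u (f k) := by
    intro k l hkl
    by_contra hne
    have hne' : (f k : Fin M) ≠ f l := fun h => hne (f.injective (Subtype.ext h))
    have h := hmono (u (f k)) {↑(f k), ↑(f l)}
    rw [Finset.sum_pair hne'] at h
    have hk := (Finset.mem_filter.1 (f k).2).2
    have hl := (Finset.mem_filter.1 (f l).2).2
    simp only [err] at hk hl hkl
    rw [← hkl] at hl
    linarith
  have hsum : ∀ g : Fin M → Matrix (Fin n → d) (Fin n → d) ℂ,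
      ∑ k, g (f k) = ∑ k ∈ s, g k := fun g => by
    rw [f.sum_comp (fun k => g k), Finset.sum_coe_sort]
  refine ⟨⟨s.card, by exact_mod_cast hs, fun k => u (f k), hinj, fun k => D (f k),
    fun k => hD0 _, ?_⟩, hcard.le, ?_⟩
  · open scoped MatrixOrder in
    rw [hsum]
    exact Matrix.le_iff.1 ((Finset.sum_le_sum_of_subset_of_nonneg s.subset_univ
      fun k _ _ => (hD0 k).nonneg).trans (Matrix.le_iff.2 hD1))
  · change 1 / (s.card : ℝ) * ∑ k, err (f k) ≤ 2 * e
    rw [f.sum_comp (fun k => err k), Finset.sum_coe_sort, one_div_mul_eq_div, div_le_iff₀ hs]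
    have h1 : ∑ k ∈ s, err k ≤ M * e := (Finset.sum_le_sum_of_subset_of_nonneg s.subset_univ
      fun k _ _ => herr k).trans hu
    have h0 : 0 ≤ ∑ k, err k := Finset.sum_nonneg fun k _ => herr k
    have : 0 ≤ M * e := h0.trans hu
    have he0 : 0 ≤ e := by
      by_contra! h; nlinarith
    nlinarith

end Expurgation

/-! ### Tensor products of matrices -/

section Tensor

variable {d : Type*} {n : ℕ}

/-- The tensor product `A 0 ⊗ ⋯ ⊗ A (n - 1)` of square matrices, in the product basis, which is
indexed by `Fin n → d`. -/
def tensorMatrix (A : Fin n → Matrix d d ℂ) : Matrix (Fin n → d) (Fin n → d) ℂ :=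
  Matrix.of fun i j => ∏ t, A t (i t) (j t)

lemma tensorMatrix_conjTranspose (A : Fin n → Matrix d d ℂ) :
    (tensorMatrix A)ᴴ = tensorMatrix fun t => (A t)ᴴ := by
  ext i j
  simp [tensorMatrix, Matrix.conjTranspose_apply]

lemma tensorMatrix_diagonal [DecidableEq d] (a : Fin n → d → ℂ) :
    tensorMatrix (fun t => Matrix.diagonal (a t)) =
      Matrix.diagonal fun i : Fin n → d => ∏ t, a t (i t) := by
  ext i j
  simp only [tensorMatrix, Matrix.of_apply, Matrix.diagonal_apply]
  split_ifs with h
  · subst h; simp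
  · obtain ⟨t, ht⟩ := Function.ne_iff.1 h
    exact Finset.prod_eq_zero (Finset.mem_univ t) (if_neg ht)

lemma tensorMatrix_one [DecidableEq d] :
    tensorMatrix (fun _ : Fin n => (1 : Matrix d d ℂ)) = 1 := by
  simp_rw [← Matrix.diagonal_one, tensorMatrix_diagonal]
  simp

variable [Fintype d]

lemma tensorMatrix_mul (A B : Fin n → Matrix d d ℂ) :
    tensorMatrix A * tensorMatrix B = tensorMatrix fun t => A t * B t := by
  classical
  ext i j
  simp only [tensorMatrix, Matrix.mul_apply, Matrix.of_apply, ← Finset.prod_mul_distrib]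
  rw [Finset.prod_univ_sum, Fintype.piFinset_univ]

lemma tensorMatrix_trace (A : Fin n → Matrix d d ℂ) :
    (tensorMatrix A).trace = ∏ t, (A t).trace := by
  classical
  simp only [tensorMatrix, Matrix.trace, Matrix.diag_apply, Matrix.of_apply]
  rw [Finset.prod_univ_sum, Fintype.piFinset_univ]

/-- The output states average, under the product law of `p`, to the tensor power of the mixture. -/
lemma sum_smul_outputState {X d : Type*} {n : ℕ} [Fintype X] (ρ : X → Matrix d d ℂ) (p : X → ℝ) :
    ∑ u : Fin n → X, (∏ k, p (u k)) • outputState ρ u = tensorMatrix fun _ => mixture ρ p := by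
  classical
  ext i j
  simp only [Matrix.sum_apply, Matrix.smul_apply, outputState, tensorMatrix, Matrix.of_apply,
    mixture]
  rw [Finset.prod_univ_sum, Fintype.piFinset_univ]
  refine Finset.sum_congr rfl fun u _ => ?_
  simp [Finset.prod_mul_distrib]

end Tensor

/-! ### Spectral decompositions and projections -/

section Spectral

variable {m : Type*} [Fintype m] [DecidableEq m]

/-- The data of a spectral decomposition `A = V diag(a) Vᴴ`, with `V` unitary. -/
structure IsSpectralDecomposition (A V : Matrix m m ℂ) (a : m → ℝ) : Prop where
  conjTranspose_mul_self : Vᴴ * V = 1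
  eq : A = V * Matrix.diagonal (fun i => (a i : ℂ)) * Vᴴ

/-- The orthogonal projection onto the span of the columns of the unitary `V` with index in `s`. -/
def columnProjection (V : Matrix m m ℂ) (s : Finset m) : Matrix m m ℂ :=
  V * Matrix.diagonal (fun i => if i ∈ s then 1 else 0) * Vᴴ

lemma conjugate_diagonal_mul {V : Matrix m m ℂ} (hV : Vᴴ * V = 1) (a b : m → ℂ) :
    (V * Matrix.diagonal a * Vᴴ) * (V * Matrix.diagonal b * Vᴴ) =
      V * Matrix.diagonal (fun i => a i * b i) * Vᴴ := by
  rw [← Matrix.diagonal_mul_diagonal]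
  calc _ = V * Matrix.diagonal a * (Vᴴ * V) * Matrix.diagonal b * Vᴴ := by noncomm_ring
    _ = _ := by rw [hV]; noncomm_ring

lemma conjugate_diagonal_trace {V : Matrix m m ℂ} (hV : Vᴴ * V = 1) (a : m → ℂ) :
    (V * Matrix.diagonal a * Vᴴ).trace = ∑ i, a i := by
  rw [Matrix.trace_mul_comm, ← mul_assoc, hV, one_mul, Matrix.trace_diagonal]

lemma conjugate_diagonal_posSemidef (V : Matrix m m ℂ) {a : m → ℂ} (ha : 0 ≤ a) :
    (V * Matrix.diagonal a * Vᴴ).PosSemidef :=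
  (Matrix.PosSemidef.diagonal ha).mul_mul_conjTranspose_same V

lemma columnProjection_posSemidef (V : Matrix m m ℂ) (s : Finset m) :
    (columnProjection V s).PosSemidef :=
  conjugate_diagonal_posSemidef V fun i => by simp only [Pi.zero_apply]; split_ifs <;> simp

lemma columnProjection_mul_self {V : Matrix m m ℂ} (hV : Vᴴ * V = 1) (s : Finset m) :
    columnProjection V s * columnProjection V s = columnProjection V s := by
  rw [columnProjection, conjugate_diagonal_mul hV]
  congr 3
  ext i
  by_cases hi : i ∈ s <;> simp [hi]

lemma one_sub_columnProjection {V : Matrix m m ℂ} (hV : Vᴴ * V = 1) (s : Finset m) :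
    1 - columnProjection V s = columnProjection V sᶜ := by
  have h1 : (1 : Matrix m m ℂ) = V * Matrix.diagonal (fun _ => 1) * Vᴴ := by
    rw [Matrix.diagonal_one, mul_one, mul_eq_one_comm.1 hV]
  rw [h1, columnProjection, columnProjection, ← sub_mul, ← mul_sub, Matrix.diagonal_sub]
  congr 3
  ext i
  by_cases hi : i ∈ s <;> simp [hi]

lemma columnProjection_trace {V : Matrix m m ℂ} (hV : Vᴴ * V = 1) (s : Finset m) :
    (columnProjection V s).trace.re = s.card := by
  rw [columnProjection, conjugate_diagonal_trace hV]
  simp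

namespace IsSpectralDecomposition

variable {A V : Matrix m m ℂ} {a : m → ℝ}

lemma posSemidef (h : IsSpectralDecomposition A V a) (ha : ∀ i, 0 ≤ a i) : A.PosSemidef := by
  rw [h.eq]
  exact conjugate_diagonal_posSemidef V fun i => by simpa using ha i

lemma trace_mul_columnProjection (h : IsSpectralDecomposition A V a) (s : Finset m) :
    (A * columnProjection V s).trace.re = ∑ i ∈ s, a i := by
  rw [h.eq, columnProjection, conjugate_diagonal_mul h.conjTranspose_mul_self,
    conjugate_diagonal_trace h.conjTranspose_mul_self]
  simp

/-- If the eigenvalues of `A` with index in `s` are at most `c`, then so is the compression of `A`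
to the corresponding eigenspaces. -/
lemma compress_le (h : IsSpectralDecomposition A V a) {c : ℝ} (s : Finset m) (hc : 0 ≤ c)
    (hs : ∀ i ∈ s, a i ≤ c) :
    (c • (1 : Matrix m m ℂ) - columnProjection V s * A * columnProjection V s).PosSemidef := by
  have h1 : c • (1 : Matrix m m ℂ) = V * Matrix.diagonal (fun _ => (c : ℂ)) * Vᴴ := by
    have : Matrix.diagonal (fun _ : m => (c : ℂ)) = c • 1 := by
      ext i j; simp [Matrix.diagonal_apply, Matrix.one_apply]
    rw [this, mul_smul_comm, smul_mul_assoc, mul_one, mul_eq_one_comm.1 h.conjTranspose_mul_self]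
  rw [h1, h.eq, columnProjection, conjugate_diagonal_mul h.conjTranspose_mul_self,
    conjugate_diagonal_mul h.conjTranspose_mul_self, ← sub_mul, ← mul_sub, Matrix.diagonal_sub]
  refine conjugate_diagonal_posSemidef V fun i => ?_
  by_cases hi : i ∈ s
  · simpa [hi] using hs i hi
  · simpa [hi] using hc

end IsSpectralDecomposition

lemma IsSpectralDecomposition.tensorMatrix {d : Type*} [Fintype d] [DecidableEq d] {n : ℕ}
    {A V : Fin n → Matrix d d ℂ} {a : Fin n → d → ℝ}
    (h : ∀ t, IsSpectralDecomposition (A t) (V t) (a t)) :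
    IsSpectralDecomposition (tensorMatrix A) (tensorMatrix V) fun i => ∏ t, a t (i t) where
  conjTranspose_mul_self := by
    rw [tensorMatrix_conjTranspose, tensorMatrix_mul]
    simp_rw [(h _).conjTranspose_mul_self, tensorMatrix_one]
  eq := by
    simp_rw [Complex.ofReal_prod]
    rw [← tensorMatrix_diagonal (fun t i => (a t i : ℂ)), tensorMatrix_conjTranspose,
      tensorMatrix_mul, tensorMatrix_mul]
    exact congrArg _ (funext fun t => (h t).eq)

lemma IsDensityOperator.exists_isSpectralDecomposition {A : Matrix m m ℂ}
    (hA : IsDensityOperator A) :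
    ∃ V a, IsSpectralDecomposition A V a ∧ (∀ i, 0 ≤ a i) ∧ ∑ i, a i = 1 ∧
      entropy A = ∑ i, a i * -Real.log (a i) := by
  have hH := hA.1.isHermitian
  set V : Matrix m m ℂ := hH.eigenvectorUnitary.1
  have hV : Vᴴ * V = 1 := Unitary.coe_star_mul_self hH.eigenvectorUnitary
  have heq : A = V * Matrix.diagonal (fun i => (hH.eigenvalues i : ℂ)) * Vᴴ := hH.spectral_theorem
  have hlog : matrixLog A =
      V * Matrix.diagonal (fun i => (Real.log (hH.eigenvalues i) : ℂ)) * Vᴴ := hH.cfc_eq Real.log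
  refine ⟨V, hH.eigenvalues, ⟨hV, heq⟩, hA.1.eigenvalues_nonneg, ?_, ?_⟩
  · have := hA.2
    rw [heq, conjugate_diagonal_trace hV] at this
    exact_mod_cast this
  · rw [entropy, hlog]
    nth_rw 1 [heq]
    rw [conjugate_diagonal_mul hV, conjugate_diagonal_trace hV]
    simp [← Complex.ofReal_mul]

end Spectral

lemma isDensityOperator_tensorMatrix {d : Type*} [Fintype d] [DecidableEq d] {n : ℕ}
    {A : Fin n → Matrix d d ℂ} (hA : ∀ t, IsDensityOperator (A t)) :
    IsDensityOperator (tensorMatrix A) := by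
  choose V a h h0 _ _ using fun t => (hA t).exists_isSpectralDecomposition
  refine ⟨(IsSpectralDecomposition.tensorMatrix h).posSemidef fun i =>
    Finset.prod_nonneg fun t _ => h0 t _, ?_⟩
  rw [tensorMatrix_trace]
  exact Finset.prod_eq_one fun t _ => (hA t).2

lemma isDensityOperator_mixture {X d : Type*} [Fintype X] [Fintype d] {ρ : X → Matrix d d ℂ}
    (hρ : ∀ x, IsDensityOperator (ρ x)) {p : X → ℝ} (hp : p ∈ stdSimplex ℝ X) :
    IsDensityOperator (mixture ρ p) := by
  refine ⟨Matrix.posSemidef_sum _ fun x _ => (hρ x).1.smul (hp.1 x), ?_⟩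
  simp only [mixture, Matrix.trace_sum, Matrix.trace_smul, (hρ _).2]
  simpa [← Complex.ofReal_sum] using congrArg Complex.ofReal hp.2

/-! ### Typical projections -/

section Typicality

variable {X d : Type*} [Fintype X] [Fintype d] [DecidableEq d]

lemma log_prod_eq_neg_sum {Y : Type*} {n : ℕ} (a : Y → ℝ) {w : Fin n → Y}
    (h : 0 < ∏ t, a (w t)) : ∑ t, -Real.log (a (w t)) = -Real.log (∏ t, a (w t)) := by
  rw [Real.log_prod fun t _ => (Finset.prod_ne_zero_iff.1 h.ne') t (Finset.mem_univ t),
    Finset.sum_neg_distrib]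

/-- The words whose probability exceeds `exp (-n (H(μ) - δ))` have total probability `O(1 / n)`. -/
lemma sum_prod_le_of_exp_lt {Y : Type*} [Fintype Y] {μ : Y → ℝ} (hμ0 : ∀ y, 0 ≤ μ y)
    (hμ : ∑ y, μ y = 1) {δ : ℝ} (hδ : 0 < δ) :
    ∃ C : ℝ, ∀ n : ℕ, 0 < n → ∀ s : Finset (Fin n → Y),
      (∀ w ∈ s, Real.exp (-n * ((∑ y, μ y * -Real.log (μ y)) - δ)) < ∏ t, μ (w t)) →
        ∑ w ∈ s, ∏ t, μ (w t) ≤ C * (n : ℝ)⁻¹ := by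
  refine ⟨_, fun n hn s hs => weakLaw hμ0 hμ (fun y => -Real.log (μ y)) hδ hn s fun w hw => ?_⟩
  have hpos := (Real.exp_pos _).trans (hs w hw)
  have hlog := (Real.lt_log_iff_exp_lt hpos).2 (hs w hw)
  rw [log_prod_eq_neg_sum μ hpos, le_abs]
  right
  linarith

/-- For random words `u` of law `p` and random indices `i` of law `a (u t)` in each coordinate,
the pairs with conditional probability below `exp (-n (H(a | p) + δ))` have total probability
`O(1 / n)`. This is the weak law for the joint law `p x * a x i` on `X × d`. -/
lemma sum_prod_mul_prod_le {p : X → ℝ} (hp : p ∈ stdSimplex ℝ X) {a : X → d → ℝ}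
    (ha0 : ∀ x i, 0 ≤ a x i) (ha : ∀ x, ∑ i, a x i = 1) {δ : ℝ} (hδ : 0 < δ) :
    ∃ C : ℝ, ∀ n : ℕ, 0 < n → ∀ s : (Fin n → X) → Finset (Fin n → d),
      (∀ u, ∀ i ∈ s u, ∏ t, a (u t) (i t) <
        Real.exp (-n * ((∑ x, p x * ∑ i, a x i * -Real.log (a x i)) + δ))) →
      ∑ u : Fin n → X, (∏ t, p (u t)) * ∑ i ∈ s u, ∏ t, a (u t) (i t) ≤ C * (n : ℝ)⁻¹ := by
  classical
  set q : X × d → ℝ := fun y => p y.1 * a y.1 y.2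
  have hq0 : ∀ y, 0 ≤ q y := fun y => mul_nonneg (hp.1 _) (ha0 _ _)
  have hq : ∑ y, q y = 1 := by
    simp_rw [Fintype.sum_prod_type, q, ← Finset.mul_sum, ha, mul_one, hp.2]
  set f : X × d → ℝ := fun y => -Real.log (a y.1 y.2)
  have hqf : ∑ y, q y * f y = ∑ x, p x * ∑ i, a x i * -Real.log (a x i) := by
    simp_rw [Fintype.sum_prod_type, Finset.mul_sum, q, f, mul_assoc]
  refine ⟨_, fun n hn s hs => le_trans (le_of_eq ?_) (weakLaw hq0 hq f hδ hn
    (Finset.univ.filter fun w : Fin n → X × d =>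
      0 < ∏ t, a (w t).1 (w t).2 ∧ (fun t => (w t).2) ∈ s fun t => (w t).1) fun w hw => ?_)⟩
  -- terms with vanishing conditional probability contribute nothing, so that `log` of the
  -- product is only taken where the product is positive
  · rw [Finset.sum_filter, ← (Equiv.arrowProdEquivProdArrow (Fin n) (fun _ => X)
      (fun _ => d)).symm.sum_comp, Fintype.sum_prod_type]
    refine Finset.sum_congr rfl fun u _ => ?_
    rw [Finset.mul_sum, ← Finset.sum_filter_add_sum_filter_not Finset.univ (· ∈ s u)]
    rw [Finset.sum_eq_zero (s := Finset.univ.filter fun i => i ∉ s u), add_zero,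
      Finset.filter_univ_mem]
    · refine Finset.sum_congr rfl fun i hi => ?_
      have h0 : 0 ≤ ∏ t, a (u t) (i t) := Finset.prod_nonneg fun t _ => ha0 _ _
      rcases h0.eq_or_lt with h | h
      · simp [Equiv.arrowProdEquivProdArrow, ← h]
      · simp [Equiv.arrowProdEquivProdArrow, h, hi, q, Finset.prod_mul_distrib]
    · intro i hi
      simp only [Finset.mem_filter] at hi
      simp [Equiv.arrowProdEquivProdArrow, hi.2]
  · obtain ⟨hpos, hw⟩ := (Finset.mem_filter.1 hw).2
    have hlog := (Real.log_lt_iff_lt_exp hpos).2 (hs _ _ hw)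
    rw [log_prod_eq_neg_sum (fun y : X × d => a y.1 y.2) hpos, hqf, le_abs]
    left
    linarith

lemma card_le_exp {m : Type*} [Fintype m] {a : m → ℝ} (ha0 : ∀ i, 0 ≤ a i) (ha : ∑ i, a i = 1)
    {s : Finset m} {c : ℝ} (hs : ∀ i ∈ s, Real.exp (-c) ≤ a i) : (s.card : ℝ) ≤ Real.exp c := by
  have h : (s.card : ℝ) * Real.exp (-c) ≤ 1 := by
    calc (s.card : ℝ) * Real.exp (-c) = ∑ i ∈ s, Real.exp (-c) := by simp
      _ ≤ ∑ i ∈ s, a i := Finset.sum_le_sum hs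
      _ ≤ ∑ i, a i := Finset.sum_le_sum_of_subset_of_nonneg s.subset_univ fun i _ _ => ha0 i
      _ = 1 := ha
  rwa [Real.exp_neg, ← div_eq_mul_inv, div_le_one (Real.exp_pos c)] at h

open scoped MatrixOrder Matrix.Norms.L2Operator in
/-- The tests `Q P_u Q` which distinguish the output state of the word `u` from the average output
state, for every exponent `b` below the mutual information. Here `Q` projects onto the
eigenvectors of the average state with eigenvalue at most `exp (-n (H - δ))`, and `P_u` onto the
eigenvectors of the output state of `u` with eigenvalue at least `exp (-n (K + δ))`, where `H` is
the entropy of the mixture and `K` the average entropy. There are at most `exp (n (K + δ))` of the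
latter. -/
lemma exists_tests (ρ : X → Matrix d d ℂ) (hρ : ∀ x, IsDensityOperator (ρ x)) {p : X → ℝ}
    (hp : p ∈ stdSimplex ℝ X) {b : ℝ} (hb : b < mutualInformation ρ p) :
    ∃ C : ℝ, ∀ n : ℕ, 0 < n → ∃ T : (Fin n → X) → Matrix (Fin n → d) (Fin n → d) ℂ,
      (∀ u, 0 ≤ T u) ∧ (∀ u, T u ≤ 1) ∧
      ∑ u : Fin n → X, (∏ k, p (u k)) * (1 - (outputState ρ u * T u).trace.re) ≤ C * (n : ℝ)⁻¹ ∧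
      ∀ u, ((∑ v : Fin n → X, (∏ k, p (v k)) • outputState ρ v) * T u).trace.re ≤
        Real.exp (-n * b) := by
  classical
  choose V a hVa ha0 ha hHa using fun x => (hρ x).exists_isSpectralDecomposition
  obtain ⟨U, μ, hUμ, hμ0, hμ, hHμ⟩ :=
    (isDensityOperator_mixture hρ hp).exists_isSpectralDecomposition
  have hI : mutualInformation ρ p = entropy (mixture ρ p) - ∑ x, p x * entropy (ρ x) := rfl
  set δ := (mutualInformation ρ p - b) / 2
  have hδ : 0 < δ := half_pos (sub_pos.2 hb)
  obtain ⟨C₁, hC₁⟩ := sum_prod_le_of_exp_lt hμ0 hμ hδ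
  obtain ⟨C₂, hC₂⟩ := sum_prod_mul_prod_le hp ha0 ha hδ
  simp_rw [← hHμ] at hC₁
  simp_rw [← hHa] at hC₂
  set H := entropy (mixture ρ p)
  set K := ∑ x, p x * entropy (ρ x)
  refine ⟨3 * C₁ + 2 * C₂, fun n hn => ?_⟩
  rw [sum_smul_outputState]
  set σ := tensorMatrix fun _ : Fin n => mixture ρ p
  have hσ : IsDensityOperator σ := isDensityOperator_tensorMatrix fun _ =>
    isDensityOperator_mixture hρ hp
  have hSσ : IsSpectralDecomposition σ _ _ := IsSpectralDecomposition.tensorMatrix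
    fun _ : Fin n => hUμ
  have hSρ : ∀ u : Fin n → X, IsSpectralDecomposition (outputState ρ u) _ _ := fun u =>
    IsSpectralDecomposition.tensorMatrix fun t => hVa (u t)
  have hτ : ∀ u : Fin n → X, IsDensityOperator (outputState ρ u) := fun u =>
    isDensityOperator_tensorMatrix fun t => hρ (u t)
  -- the typical projection of the mixture
  set s : Finset (Fin n → d) :=
    Finset.univ.filter fun i => ∏ t, μ (i t) ≤ Real.exp (-n * (H - δ))
  set Q := columnProjection (tensorMatrix fun _ : Fin n => U) s
  -- the conditionally typical projection of the word `u`
  set r : (Fin n → X) → Finset (Fin n → d) := fun u =>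
    Finset.univ.filter fun i => Real.exp (-n * (K + δ)) ≤ ∏ t, a (u t) (i t)
  set P : (Fin n → X) → Matrix (Fin n → d) (Fin n → d) ℂ :=
    fun u => columnProjection (tensorMatrix fun t => V (u t)) (r u)
  have hQ0 : Q.PosSemidef := columnProjection_posSemidef _ _
  have hQs : IsSelfAdjoint Q := hQ0.isHermitian
  have hQQ : Q * Q = Q := columnProjection_mul_self hSσ.conjTranspose_mul_self s
  have hP0 : ∀ u, (P u).PosSemidef := fun u => columnProjection_posSemidef _ _
  have hP1 : ∀ u, P u ≤ 1 := fun u => by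
    rw [Matrix.le_iff, one_sub_columnProjection (hSρ u).conjTranspose_mul_self]
    exact columnProjection_posSemidef _ _
  have hQerr : 1 - (σ * Q).trace.re ≤ C₁ * (n : ℝ)⁻¹ := by
    have h := hSσ.trace_mul_columnProjection sᶜ
    rw [← one_sub_columnProjection hSσ.conjTranspose_mul_self, mul_sub, mul_one, Matrix.trace_sub,
      hσ.2, Complex.sub_re, Complex.one_re] at h
    rw [h]
    exact hC₁ n hn sᶜ fun w hw => by simpa [s] using hw
  have hPerr : ∑ u : Fin n → X, (∏ t, p (u t)) * (1 - (outputState ρ u * P u).trace.re) ≤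
      C₂ * (n : ℝ)⁻¹ := by
    refine le_trans (le_of_eq (Finset.sum_congr rfl fun u _ => ?_))
      (hC₂ n hn (fun u => (r u)ᶜ) fun u i hi => by simpa [r] using hi)
    have h := (hSρ u).trace_mul_columnProjection (r u)ᶜ
    rw [← one_sub_columnProjection (hSρ u).conjTranspose_mul_self, mul_sub, mul_one,
      Matrix.trace_sub, (hτ u).2, Complex.sub_re, Complex.one_re] at h
    rw [h]
  have hQavg : ∑ u : Fin n → X, (∏ t, p (u t)) * (1 - (outputState ρ u * Q).trace.re) =
      1 - (σ * Q).trace.re := by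
    have h : (σ * Q).trace.re =
        ∑ u : Fin n → X, (∏ t, p (u t)) * (outputState ρ u * Q).trace.re := by
      rw [show σ = _ from (sum_smul_outputState ρ p).symm, Finset.sum_mul,
        Matrix.trace_sum, Complex.re_sum]
      refine Finset.sum_congr rfl fun u _ => ?_
      rw [smul_mul_assoc, Matrix.trace_smul, Complex.smul_re, smul_eq_mul]
    simp_rw [mul_sub, Finset.sum_sub_distrib, mul_one, sum_prod_eq_one hp.2, ← h]
  refine ⟨fun u => Q * P u * Q, fun u => hQs.conjugate_nonneg (hP0 u).nonneg, fun u => ?_, ?_,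
    fun u => ?_⟩
  · calc Q * P u * Q ≤ Q * 1 * Q := hQs.conjugate_le_conjugate (hP1 u)
      _ ≤ 1 := by
        rw [mul_one, hQQ, Matrix.le_iff, one_sub_columnProjection hSσ.conjTranspose_mul_self]
        exact columnProjection_posSemidef _ _
  · calc _ ≤ ∑ u : Fin n → X, (∏ k, p (u k)) * (3 * (1 - (outputState ρ u * Q).trace.re) +
          2 * (1 - (outputState ρ u * P u).trace.re)) := by
          refine Finset.sum_le_sum fun u _ => mul_le_mul_of_nonneg_left ?_
            (Finset.prod_nonneg fun k _ => hp.1 _)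
          have h := trace_mul_re_mono (hτ u).1
            (one_sub_conjugate_le (hP0 u).nonneg (hP1 u) hQs hQQ)
          simp only [mul_add, mul_sub, mul_one, mul_smul_comm, Matrix.trace_sub,
            Matrix.trace_add, Matrix.trace_smul, (hτ u).2, Complex.sub_re, Complex.add_re,
            Complex.re_nsmul] at h
          simp only [nsmul_eq_mul, Complex.one_re] at h
          push_cast at h
          linarith
      _ ≤ (3 * C₁ + 2 * C₂) * (n : ℝ)⁻¹ := by
          simp_rw [mul_add, Finset.sum_add_distrib, mul_left_comm _ (3 : ℝ),
            mul_left_comm _ (2 : ℝ), ← Finset.mul_sum, hQavg]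
          linarith
  · have h1 : (σ * (Q * P u * Q)).trace = (P u * (Q * σ * Q)).trace := by
      rw [← mul_assoc, Matrix.trace_mul_comm, ← mul_assoc, ← mul_assoc, Matrix.trace_mul_comm]
    have h2 := trace_mul_re_mono (hP0 u) (Matrix.le_iff.2 (hSσ.compress_le s
      (Real.exp_pos (-n * (H - δ))).le fun i hi => (Finset.mem_filter.1 hi).2))
    have h3 : ((r u).card : ℝ) ≤ Real.exp (n * (K + δ)) := by
      refine card_le_exp (a := fun i => ∏ t, a (u t) (i t))
        (fun i => Finset.prod_nonneg fun t _ => ha0 _ _) ?_ fun i hi => ?_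
      · rw [← Fintype.piFinset_univ, ← Finset.prod_univ_sum]
        simp [ha]
      · rw [← neg_mul]; exact (Finset.mem_filter.1 hi).2
    rw [h1]
    refine h2.trans ?_
    rw [mul_smul_comm, mul_one, Matrix.trace_smul, Complex.smul_re, smul_eq_mul,
      columnProjection_trace (hSρ u).conjTranspose_mul_self]
    calc _ ≤ Real.exp (-n * (H - δ)) * Real.exp (n * (K + δ)) :=
          mul_le_mul_of_nonneg_left h3 (Real.exp_pos _).le
      _ = Real.exp (-n * b) := by
          rw [← Real.exp_add]
          congr 1
          have : 2 * δ = H - K - b := by simp only [δ]; rw [hI]; ring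
          linear_combination (n : ℝ) * this

end Typicality

/-! ### Achievable rates -/

section Achievability

variable {X d : Type*} [Fintype d] [DecidableEq d]

lemma isDensityOperator_outputState {ρ : X → Matrix d d ℂ} (hρ : ∀ x, IsDensityOperator (ρ x))
    {n : ℕ} (u : Fin n → X) : IsDensityOperator (outputState ρ u) :=
  isDensityOperator_tensorMatrix fun t => hρ (u t)

open scoped MatrixOrder in
lemma Code.errorProb_nonneg {ρ : X → Matrix d d ℂ} (hρ : ∀ x, IsDensityOperator (ρ x)) {n : ℕ}
    (c : Code X d n) : 0 ≤ c.errorProb ρ := by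
  refine mul_nonneg (by positivity) (Finset.sum_nonneg fun k _ => ?_)
  have h1 : c.decoder k ≤ 1 := (Finset.single_le_sum (fun j _ => (c.decoder_nonneg j).nonneg)
    (Finset.mem_univ k)).trans (Matrix.le_iff.2 c.decoder_sum_le)
  have h := trace_mul_re_mono (isDensityOperator_outputState hρ (c.codeword k)).1 h1
  rw [mul_one, (isDensityOperator_outputState hρ _).2, Complex.one_re] at h
  linarith

/-- The code with the single codeword `x ⋯ x`, which the decoder always reports. -/
def Code.trivial (x : X) (n : ℕ) : Code X d n where
  size := 1
  size_pos := one_pos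
  codeword _ _ := x
  codeword_injective _ _ _ := Subsingleton.elim _ _
  decoder _ := 1
  decoder_nonneg _ := Matrix.PosSemidef.one
  decoder_sum_le := by simpa using Matrix.PosSemidef.zero

lemma Code.trivial_errorProb {ρ : X → Matrix d d ℂ} (hρ : ∀ x, IsDensityOperator (ρ x)) (x : X)
    (n : ℕ) : (Code.trivial x n).errorProb ρ = 0 := by
  simp [Code.errorProb, Code.trivial, (isDensityOperator_outputState hρ _).2]

variable [Fintype X]

/-- For `a < b < I(p)`, random coding with `M ≈ 2 exp (n a)` words and tests of exponent `b` has
error `O(1 / n) + O(M exp (-n b))`. The factor `2` in `M` makes up for the expurgation. -/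
lemma exists_code_of_rate_lt {ρ : X → Matrix d d ℂ} (hρ : ∀ x, IsDensityOperator (ρ x))
    {p : X → ℝ} (hp : p ∈ stdSimplex ℝ X) {a : ℝ} (ha0 : 0 ≤ a)
    (ha : a < mutualInformation ρ p) :
    ∃ E : ℕ → ℝ, Tendsto E atTop (𝓝 0) ∧ ∀ n : ℕ, 0 < n → E n < 1 / 4 →
      ∃ c : Code X d n, Real.exp (n * a) ≤ c.size ∧ c.errorProb ρ ≤ 2 * E n := by
  obtain ⟨b, hab, hb⟩ := exists_between ha
  obtain ⟨C, hC⟩ := exists_tests ρ hρ hp hb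
  refine ⟨fun n => 2 * (C * (n : ℝ)⁻¹) + 16 * Real.exp (-(b - a)) ^ n + 4 * (n : ℝ)⁻¹, ?_, ?_⟩
  · have h1 : Tendsto (fun n : ℕ => (n : ℝ)⁻¹) atTop (𝓝 0) := tendsto_inv_atTop_nhds_zero_nat
    have h2 : Tendsto (fun n : ℕ => Real.exp (-(b - a)) ^ n) atTop (𝓝 0) :=
      tendsto_pow_atTop_nhds_zero_of_lt_one (Real.exp_pos _).le
        (Real.exp_lt_one_iff.2 (by linarith))
    simpa using (((h1.const_mul C).const_mul 2).add (h2.const_mul 16)).add (h1.const_mul 4)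
  · intro n hn hE
    have hn' : (0 : ℝ) < n := by exact_mod_cast hn
    obtain ⟨T, hT0, hT1, hα, hβ⟩ := hC n hn
    set M := 2 * ⌈Real.exp (n * a)⌉₊ with hM
    have hMle : (M : ℝ) ≤ 4 * Real.exp (n * a) := by
      have h1 := (Nat.ceil_lt_add_one (Real.exp_pos (n * a)).le).le
      have h2 : 1 ≤ Real.exp (n * a) := Real.one_le_exp (by positivity)
      rw [hM]; push_cast; linarith
    have hMge : Real.exp (n * a) ≤ M / 2 := by
      rw [hM]; push_cast
      linarith [Nat.le_ceil (Real.exp (n * a))]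
    have hM0 : 0 < M := by
      have : (0 : ℝ) < M := by linarith [Real.exp_pos (n * a)]
      exact_mod_cast this
    obtain ⟨u, D, hD0, hD1, hD⟩ := exists_randomCode
      (fun u => Finset.prod_nonneg fun k _ => hp.1 (u k)) (sum_prod_eq_one hp.2)
      (outputState ρ) (isDensityOperator_outputState hρ) T hT0 hT1 hα hβ (inv_pos.2 hn') M
    have hMexp : M * Real.exp (-n * b) ≤ 4 * Real.exp (-(b - a)) ^ n := by
      calc M * Real.exp (-n * b) ≤ 4 * Real.exp (n * a) * Real.exp (-n * b) := by gcongr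
        _ = 4 * Real.exp (-(b - a)) ^ n := by
          rw [mul_assoc, ← Real.exp_add, ← Real.exp_nat_mul]; ring_nf
    obtain ⟨c, hc, hce⟩ := exists_code_of_words ρ (isDensityOperator_outputState hρ) hM0 u D
      hD0 hD1 hE (hD.trans (by gcongr; linarith))
    exact ⟨c, hMge.trans hc, hce⟩

/-- For the finitely many block lengths at which the error bound is still too large, and for
negative rates, the code with a single word serves. -/
theorem isAchievable_of_lt_mutualInformation {ρ : X → Matrix d d ℂ}
    (hρ : ∀ x, IsDensityOperator (ρ x)) {p : X → ℝ} (hp : p ∈ stdSimplex ℝ X) {a : ℝ}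
    (ha : a < mutualInformation ρ p) : IsAchievable ρ a := by
  have hX : Nonempty X := by
    by_contra h
    rw [not_nonempty_iff] at h
    simpa using hp.2
  obtain ⟨x⟩ := hX
  rcases lt_or_ge a 0 with ha0 | ha0
  · refine ⟨Code.trivial x, ?_, ?_⟩
    · simp [Code.trivial_errorProb hρ]
    · refine le_liminf_of_le (by isBoundedDefault) (Eventually.of_forall fun n => ?_)
      simpa [Code.trivial] using ha0.le
  · obtain ⟨E, hE, hcode⟩ := exists_code_of_rate_lt hρ hp ha0 ha
    have hex : ∀ n : ℕ, ∃ c : Code X d n, 0 < n → E n < 1 / 4 →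
        Real.exp (n * a) ≤ c.size ∧ c.errorProb ρ ≤ 2 * E n := by
      intro n
      by_cases h : 0 < n ∧ E n < 1 / 4
      · obtain ⟨c, hc⟩ := hcode n h.1 h.2
        exact ⟨c, fun _ _ => hc⟩
      · exact ⟨Code.trivial x n, fun h1 h2 => absurd ⟨h1, h2⟩ h⟩
    choose c hc using hex
    have hev : ∀ᶠ n in atTop, 0 < n ∧ E n < 1 / 4 :=
      (eventually_gt_atTop 0).and (hE.eventually_lt_const (by norm_num))
    refine ⟨c, ?_, ?_⟩
    · refine squeeze_zero' (Eventually.of_forall fun n => (c n).errorProb_nonneg hρ)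
        (hev.mono fun n hn => (hc n hn.1 hn.2).2) ?_
      simpa using hE.const_mul 2
    · refine le_liminf_of_le (by isBoundedDefault) (hev.mono fun n hn => ?_)
      have hn' : (0 : ℝ) < n := by exact_mod_cast hn.1
      rw [EReal.coe_le_coe_iff, one_div, ← div_eq_inv_mul, le_div_iff₀ hn', mul_comm]
      have hs : (0 : ℝ) < (c n).size := by exact_mod_cast (c n).size_pos
      exact (Real.le_log_iff_exp_le hs).2 (hc n hn.1 hn.2).1

end Achievability

/-! ### Relative entropy, continuity and the capacity -/

section MutualInformation

variable {X d : Type*} [Fintype X] [Fintype d] [DecidableEq d]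

/-- The support of `ρ x` is contained in that of the mixture if `p x ≠ 0`. -/
lemma mulVec_eq_zero_of_mixture {X d : Type*} [Fintype X] [Fintype d] {ρ : X → Matrix d d ℂ}
    (hρ : ∀ x, IsDensityOperator (ρ x)) {p : X → ℝ} (hp : p ∈ stdSimplex ℝ X) {x : X}
    (hx : p x ≠ 0) {v : d → ℂ} (hv : mixture ρ p *ᵥ v = 0) : ρ x *ᵥ v = 0 := by
  rw [← (hρ x).1.dotProduct_mulVec_zero_iff]
  have h0 : ∑ y, p y • (star v ⬝ᵥ (ρ y *ᵥ v)) = 0 := by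
    have := congrArg (star v ⬝ᵥ ·) hv
    simpa [mixture, Matrix.sum_mulVec, dotProduct_sum, Matrix.smul_mulVec] using this
  have h1 := (Finset.sum_eq_zero_iff_of_nonneg fun y _ =>
    smul_nonneg (hp.1 y) ((hρ y).1.dotProduct_mulVec_nonneg v)).1 h0 x (Finset.mem_univ x)
  exact (smul_eq_zero.1 h1).resolve_left hx

lemma coe_sum_real {ι : Type*} (s : Finset ι) (f : ι → ℝ) :
    ((∑ i ∈ s, f i : ℝ) : EReal) = ∑ i ∈ s, (f i : EReal) :=
  map_sum (⟨⟨Real.toEReal, EReal.coe_zero⟩, EReal.coe_add⟩ : ℝ →+ EReal) f s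

/-- The terms with `p x = 0` vanish even where the relative entropy is infinite. -/
theorem mutualInformation_eq_sum_relativeEntropy {ρ : X → Matrix d d ℂ}
    (hρ : ∀ x, IsDensityOperator (ρ x)) {p : X → ℝ} (hp : p ∈ stdSimplex ℝ X) :
    (mutualInformation ρ p : EReal) =
      ∑ x, (p x : EReal) * relativeEntropy (ρ x) (mixture ρ p) := by
  have hterm : ∀ x, (p x : EReal) * relativeEntropy (ρ x) (mixture ρ p) =
      ((p x * (ρ x * (matrixLog (ρ x) - matrixLog (mixture ρ p))).trace.re : ℝ) : EReal) := by
    intro x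
    by_cases hx : p x = 0
    · simp [hx]
    · rw [relativeEntropy, if_pos fun v hv => mulVec_eq_zero_of_mixture hρ hp hx hv,
        EReal.coe_mul]
  rw [Finset.sum_congr rfl fun x _ => hterm x, ← coe_sum_real, EReal.coe_eq_coe_iff]
  have hσ : (mixture ρ p * matrixLog (mixture ρ p)).trace.re =
      ∑ x, p x * (ρ x * matrixLog (mixture ρ p)).trace.re := by
    nth_rw 1 [mixture]
    rw [Finset.sum_mul, Matrix.trace_sum, Complex.re_sum]
    simp
  simp only [mutualInformation, entropy, hσ, mul_sub, Matrix.trace_sub, Complex.sub_re,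
    Finset.sum_sub_distrib, mul_neg, Finset.sum_neg_distrib]
  ring

/-- In contrast to `Real.log`, the function `Real.negMulLog` is continuous at `0`, so that this
form of the entropy shows its continuity. -/
lemma entropy_eq_trace_cfc {A : Matrix d d ℂ} (hA : A.IsHermitian) :
    entropy A = (cfc Real.negMulLog A).trace.re := by
  have hlog : matrixLog A = cfc Real.log A := rfl
  have hmul : A * cfc Real.log A = cfc (fun x => x * Real.log x) A := by
    have hf : ∀ f : ℝ → ℝ, ContinuousOn f (spectrum ℝ A) := fun f =>
      Matrix.finite_real_spectrum.continuousOn f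
    conv_lhs => arg 1; rw [← cfc_id ℝ A hA.isSelfAdjoint]
    exact (cfc_mul _ _ A (hf _) (hf _)).symm
  have hneg : cfc Real.negMulLog A = - cfc (fun x => x * Real.log x) A := by
    rw [← cfc_neg]
    congr 1; ext x; simp [Real.negMulLog]
  rw [entropy, hlog, hmul, hneg, Matrix.trace_neg, Complex.neg_re]

lemma IsDensityOperator.spectrum_subset {A : Matrix d d ℂ} (hA : IsDensityOperator A) :
    spectrum ℝ A ⊆ Set.Icc 0 1 := by
  have hH := hA.1.isHermitian
  rw [hH.spectrum_real_eq_range_eigenvalues]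
  rintro _ ⟨i, rfl⟩
  have hsum : ∑ i, hH.eigenvalues i = 1 := by
    have := hH.trace_eq_sum_eigenvalues
    rw [hA.2] at this
    exact Complex.ofReal_injective (by simpa using this.symm)
  exact ⟨hA.1.eigenvalues_nonneg i, hsum ▸
    Finset.single_le_sum (fun j _ => hA.1.eigenvalues_nonneg j) (Finset.mem_univ i)⟩

open scoped Matrix.Norms.L2Operator in
lemma continuousOn_cfc_densityOperator {f : ℝ → ℝ} (hf : Continuous f) :
    ContinuousOn (fun A : Matrix d d ℂ => cfc f A) {A | IsDensityOperator A} :=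
  ContinuousOn.cfc' (isCompact_Icc (a := (0 : ℝ)) (b := 1)) f continuousOn_id
    (fun _ hA => IsDensityOperator.spectrum_subset hA) (fun _ hA => hA.1.isHermitian)
    hf.continuousOn

lemma continuousOn_entropy :
    ContinuousOn (entropy : Matrix d d ℂ → ℝ) {A | IsDensityOperator A} := by
  have h := continuousOn_cfc_densityOperator (d := d) Real.continuous_negMulLog
  exact (Complex.continuous_re.comp_continuousOn
    ((Continuous.matrix_trace continuous_id).comp_continuousOn h)).congr
    fun A hA => entropy_eq_trace_cfc hA.1.isHermitian

lemma continuousOn_mutualInformation {ρ : X → Matrix d d ℂ} (hρ : ∀ x, IsDensityOperator (ρ x)) :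
    ContinuousOn (mutualInformation ρ) (stdSimplex ℝ X) := by
  have h1 : Continuous (mixture ρ) := by unfold mixture; fun_prop
  have h2 : ContinuousOn (fun p => entropy (mixture ρ p)) (stdSimplex ℝ X) :=
    continuousOn_entropy.comp h1.continuousOn fun p hp => isDensityOperator_mixture hρ hp
  exact h2.sub (by fun_prop)

lemma mutualInformation_le_capacity {ρ : X → Matrix d d ℂ} (hρ : ∀ x, IsDensityOperator (ρ x))
    {p : X → ℝ} (hp : p ∈ stdSimplex ℝ X) : (mutualInformation ρ p : EReal) ≤ capacity ρ := by
  refine EReal.ge_of_forall_gt_iff_ge.1 fun a ha => ?_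
  exact le_iSup₂_of_le (f := fun (R : ℝ) (_ : R ∈ {R : ℝ | IsAchievable ρ R}) => (R : EReal)) a
    (isAchievable_of_lt_mutualInformation hρ hp (EReal.coe_lt_coe_iff.1 ha)) le_rfl

end MutualInformation

end QuantumChannel

end

theorem mainTheorem1 {X d : Type*} [Fintype X] [Nonempty X] [Fintype d] [DecidableEq d]
    (ρ : X → Matrix d d ℂ) (hρ : ∀ x, QuantumChannel.IsDensityOperator (ρ x)) :
    (∀ p ∈ stdSimplex ℝ X,
      (QuantumChannel.mutualInformation ρ p : EReal) =
        ∑ x, (p x : EReal) *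
          QuantumChannel.relativeEntropy (ρ x) (QuantumChannel.mixture ρ p)) ∧
    (∀ p ∈ stdSimplex ℝ X, ∀ a : ℝ, a < QuantumChannel.mutualInformation ρ p →
      QuantumChannel.IsAchievable ρ a) ∧
    (∃ p ∈ stdSimplex ℝ X,
      IsMaxOn (QuantumChannel.mutualInformation ρ) (stdSimplex ℝ X) p ∧
      (QuantumChannel.mutualInformation ρ p : EReal) ≤ QuantumChannel.capacity ρ) := by
  classical
  refine ⟨fun p hp => QuantumChannel.mutualInformation_eq_sum_relativeEntropy hρ hp,
    fun p hp a ha => QuantumChannel.isAchievable_of_lt_mutualInformation hρ hp ha, ?_⟩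
  obtain ⟨p, hp, hmax⟩ := (isCompact_stdSimplex ℝ X).exists_isMaxOn
    ⟨_, single_mem_stdSimplex ℝ (Classical.arbitrary X)⟩
    (QuantumChannel.continuousOn_mutualInformation hρ)
  exact ⟨p, hp, hmax, QuantumChannel.mutualInformation_le_capacity hρ hp⟩
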